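/- Let $S$ be a semilattice, that is, a commutative semigroup (with or without an identity element) in which $s^2=s$ for every $s\in S$, and let $\ell^1(S)$ be its complex $\ell^1$-convolution algebra, with product $(f*g)(s)=\sum_{xy=s}f(x)g(y)$. Let $M$ be a Banach $\ell^1(S)$-bimodule that is symmetric, i.e. $a\cdot x=x\cdot a$ for all $a\in\ell^1(S)$ and $x\in M$. Then the continuous Hochschild cohomology groups satisfy \[ H^n(\ell^1(S),M)=0\qquad\text{for all } n\ge 1. \] Here, for a Banach algebra $A$ and a Banach $A$-bimodule $M$, $C^n(A,M)$ is the space of bounded $n$-linear maps $A^n\to M$, the coboundary $\delta_n:C^n(A,M)\to C^{n+1}(A,M)$ is \[ (\delta_nF)(a_1,\dots,a_{n+1})=a_1\cdot F(a_2,\dots,a_{n+1})+\sum_{j=1}^n(-1)^jF(a_1,\dots,a_ja_{j+1},\dots,a_{n+1})+(-1)^{n+1}F(a_1,\dots,a_n)\cdot a_{n+1}, \] and $H^n(A,M)=\ker\delta_n/\operatorname{im}\delta_{n-1}$ for $n\geq 1$. -/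

import Mathlib

noncomputable section

/-- The Banach space `ℓ¹(S)` of absolutely summable complex functions on `S`. -/
abbrev EllOne (S : Type*) := lp (fun _ : S => ℂ) 1

namespace EllOne

variable {S : Type*}

theorem summable_norm (f : EllOne S) : Summable fun s => ‖f s‖ := by
  simpa using (lp.memℓp f).summable (by simp)

theorem norm_eq_tsum (f : EllOne S) : ‖f‖ = ∑' s, ‖f s‖ := by
  simpa using lp.norm_eq_tsum_rpow (p := 1) (by simp) f

theorem summable_norm_prod (f g : EllOne S) :
    Summable fun p : S × S => ‖f p.1 * g p.2‖ :=
  (summable_norm f).mul_norm (summable_norm g)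

open Classical in
theorem apply_eq_tsum (f : EllOne S) (s : S) :
    f s = ∑' t, (if t = s then (1 : ℂ) else 0) * f t := by
  rw [tsum_eq_single s]
  · simp
  · intro t ht
    simp [ht]

variable [Semigroup S]

/-- Convolution: `(f * g)(s) = ∑_{xy = s} f(x) g(y)`. -/
def convFun (f g : EllOne S) (s : S) : ℂ :=
  ∑' p : {p : S × S // p.1 * p.2 = s}, f p.1.1 * g p.1.2

theorem summable_norm_sigma (f g : EllOne S) :
    Summable fun q : Σ s : S, {p : S × S // p.1 * p.2 = s} => ‖f q.2.1.1 * g q.2.1.2‖ :=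
  (Equiv.sigmaFiberEquiv fun p : S × S => p.1 * p.2).summable_iff.2 (summable_norm_prod f g)

theorem norm_convFun_le (f g : EllOne S) (s : S) :
    ‖convFun f g s‖ ≤ ∑' p : {p : S × S // p.1 * p.2 = s}, ‖f p.1.1 * g p.1.2‖ :=
  norm_tsum_le_tsum_norm ((summable_norm_sigma f g).sigma_factor s)

theorem summable_norm_convFun (f g : EllOne S) : Summable fun s => ‖convFun f g s‖ :=
  Summable.of_nonneg_of_le (fun _ => norm_nonneg _) (norm_convFun_le f g)
    (summable_norm_sigma f g).sigma

theorem tsum_norm_convFun_le (f g : EllOne S) :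
    ∑' s, ‖convFun f g s‖ ≤ ‖f‖ * ‖g‖ := by
  calc ∑' s, ‖convFun f g s‖
      ≤ ∑' s, ∑' p : {p : S × S // p.1 * p.2 = s}, ‖f p.1.1 * g p.1.2‖ :=
        (summable_norm_convFun f g).tsum_le_tsum (norm_convFun_le f g)
          (summable_norm_sigma f g).sigma
    _ = ∑' q : Σ s : S, {p : S × S // p.1 * p.2 = s}, ‖f q.2.1.1 * g q.2.1.2‖ :=
        ((summable_norm_sigma f g).tsum_sigma).symm
    _ = ∑' p : S × S, ‖f p.1 * g p.2‖ :=
        (Equiv.sigmaFiberEquiv fun p : S × S => p.1 * p.2).tsum_eq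
          fun p : S × S => ‖f p.1 * g p.2‖
    _ = ‖f‖ * ‖g‖ := by
        rw [norm_eq_tsum, norm_eq_tsum,
          (summable_norm f).tsum_mul_tsum (summable_norm g)]
        · simp only [norm_mul]
        · simpa only [norm_mul] using summable_norm_prod f g

instance : Mul (EllOne S) where
  mul f g := ⟨convFun f g, by
    refine memℓp_gen ?_
    simpa using summable_norm_convFun f g⟩

theorem mul_apply (f g : EllOne S) (s : S) :
    (f * g) s = ∑' p : {p : S × S // p.1 * p.2 = s}, f p.1.1 * g p.1.2 := rfl

theorem summable_fiber (f g : EllOne S) (s : S) :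
    Summable fun p : {p : S × S // p.1 * p.2 = s} => f p.1.1 * g p.1.2 :=
  ((summable_norm_sigma f g).sigma_factor s).of_norm

theorem summable_bdd {ι : Type*} {u : ι → ℂ} (hu : Summable fun i => ‖u i‖) {φ : ι → ℂ}
    (hφ : ∀ i, ‖φ i‖ ≤ 1) : Summable fun i => φ i * u i := by
  refine Summable.of_norm_bounded hu fun i => ?_
  rw [norm_mul]
  exact mul_le_of_le_one_left (norm_nonneg _) (hφ i)

/-- Pairing a convolution product with a bounded function. -/
theorem tsum_mul_apply (f g : EllOne S) {φ : S → ℂ} (hφ : ∀ s, ‖φ s‖ ≤ 1) :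
    ∑' s, φ s * (f * g) s = ∑' x, ∑' y, φ (x * y) * (f x * g y) := by
  have h1 : Summable fun p : S × S => φ (p.1 * p.2) * (f p.1 * g p.2) :=
    summable_bdd (summable_norm_prod f g) fun p => hφ _
  rw [← h1.tsum_prod, ← (Equiv.sigmaFiberEquiv fun p : S × S => p.1 * p.2).tsum_eq,
    Summable.tsum_sigma]
  · refine tsum_congr fun s => ?_
    rw [mul_apply, ← tsum_mul_left]
    refine tsum_congr fun p => ?_
    simp [Equiv.sigmaFiberEquiv, p.2]
  · exact (Equiv.sigmaFiberEquiv fun p : S × S => p.1 * p.2).summable_iff.2 h1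

theorem mul_assoc' (f g h : EllOne S) : f * g * h = f * (g * h) := by
  classical
  ext s
  set δ : S → ℂ := fun t => if t = s then (1 : ℂ) else 0 with hδ
  have hb : ∀ t, ‖δ t‖ ≤ 1 := fun t => by
    simp only [hδ]; split_ifs <;> simp
  have hprod : Summable fun p : S × S => δ (p.1 * p.2) * ((f * g) p.1 * h p.2) :=
    summable_bdd (summable_norm_prod (f * g) h) fun p => hb _
  rw [apply_eq_tsum (f * g * h) s, apply_eq_tsum (f * (g * h)) s]
  change ∑' t, δ t * (f * g * h) t = ∑' t, δ t * (f * (g * h)) t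
  rw [tsum_mul_apply _ _ hb, tsum_mul_apply _ _ hb]
  have e1 : ∀ t, ∑' z, δ (t * z) * ((f * g) t * h z) = (∑' z, δ (t * z) * h z) * (f * g) t := by
    intro t
    rw [← tsum_mul_right]
    exact tsum_congr fun z => by ring
  have e2 : ∀ x, ∑' t, δ (x * t) * (f x * (g * h) t)
      = f x * ∑' y, ∑' z, δ (x * (y * z)) * (g y * h z) := by
    intro x
    rw [← tsum_mul_apply g h (φ := fun t => δ (x * t)) (fun t => hb _), ← tsum_mul_left]
    exact tsum_congr fun z => by ring
  simp_rw [e1, e2]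
  -- scale so that the pairing function is bounded by `1`
  set ψ : S → ℂ := fun t => ∑' z, δ (t * z) * h z with hψ
  have hψb : ∀ t, ‖ψ t‖ ≤ ‖h‖ := by
    intro t
    rw [norm_eq_tsum]
    refine tsum_of_norm_bounded (summable_norm h).hasSum fun z => ?_
    rw [norm_mul]
    exact mul_le_of_le_one_left (norm_nonneg _) (hb _)
  have key : ∑' t, ψ t * (f * g) t = ∑' x, ∑' y, ψ (x * y) * (f x * g y) := by
    have hpos : (0 : ℝ) < ‖h‖ + 1 := by positivity
    have hc : ((‖h‖ + 1 : ℝ) : ℂ) ≠ 0 := by exact_mod_cast hpos.ne'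
    have hs := tsum_mul_apply f g (φ := fun t => ((‖h‖ + 1 : ℝ) : ℂ)⁻¹ * ψ t) (by
      intro t
      rw [norm_mul, norm_inv, Complex.norm_real, Real.norm_of_nonneg hpos.le]
      rw [inv_mul_le_iff₀ hpos]
      linarith [hψb t])
    simp_rw [mul_assoc, tsum_mul_left] at hs
    exact mul_left_cancel₀ (inv_ne_zero hc) hs
  rw [key]
  refine tsum_congr fun x => ?_
  rw [← tsum_mul_left]
  refine tsum_congr fun y => ?_
  simp only [hψ]
  rw [← tsum_mul_left, ← tsum_mul_right]
  refine tsum_congr fun z => ?_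
  rw [mul_assoc x y z]
  ring

/-- `ℓ¹(S)` with convolution and the `ℓ¹`-norm is a (possibly non-unital) Banach algebra. -/
instance : NonUnitalNormedRing (EllOne S) :=
  { lp.normedAddCommGroup with
    mul := (· * ·)
    left_distrib := fun f g h => by
      ext s
      simp only [lp.coeFn_add, Pi.add_apply, mul_apply, mul_add]
      exact (summable_fiber f g s).tsum_add (summable_fiber f h s)
    right_distrib := fun f g h => by
      ext s
      simp only [lp.coeFn_add, Pi.add_apply, mul_apply, add_mul]
      exact (summable_fiber f h s).tsum_add (summable_fiber g h s)
    zero_mul := fun f => by ext s; simp [mul_apply]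
    mul_zero := fun f => by ext s; simp [mul_apply]
    mul_assoc := mul_assoc'
    norm_mul_le := fun f g => by
      rw [norm_eq_tsum (f * g)]
      exact tsum_norm_convFun_le f g }

instance : IsScalarTower ℂ (EllOne S) (EllOne S) where
  smul_assoc c f g := by
    ext s
    simp only [smul_eq_mul, lp.coeFn_smul, Pi.smul_apply, mul_apply, mul_assoc, tsum_mul_left]

instance : SMulCommClass ℂ (EllOne S) (EllOne S) where
  smul_comm c f g := by
    ext s
    simp only [smul_eq_mul, lp.coeFn_smul, Pi.smul_apply, mul_apply, mul_left_comm _ c,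
      tsum_mul_left]

end EllOne

section Hochschild

variable {A M : Type*} [NonUnitalNormedRing A] [NormedSpace ℂ A]
  [NormedAddCommGroup M] [NormedSpace ℂ M]

/-- A Banach `A`-bimodule structure on the Banach space `M`: commuting bounded left and right
actions of `A`. Here `left a x` is `a · x` and `right a x` is `x · a`. No unit is assumed to act
as the identity. -/
structure BanachBimodule (A M : Type*) [NonUnitalNormedRing A] [NormedSpace ℂ A]
    [NormedAddCommGroup M] [NormedSpace ℂ M] where
  left : A →L[ℂ] M →L[ℂ] M
  right : A →L[ℂ] M →L[ℂ] M
  left_mul : ∀ (a b : A) (x : M), left (a * b) x = left a (left b x)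
  right_mul : ∀ (a b : A) (x : M), right (a * b) x = right b (right a x)
  left_right : ∀ (a b : A) (x : M), left a (right b x) = right b (left a x)

/-- The bimodule is symmetric: `a · x = x · a`. -/
def BanachBimodule.IsSymmetric (X : BanachBimodule A M) : Prop :=
  ∀ (a : A) (x : M), X.left a x = X.right a x

/-- Bounded `n`-linear maps `Aⁿ → M`. -/
abbrev HochschildCochain (A M : Type*) [NonUnitalNormedRing A] [NormedSpace ℂ A]
    [NormedAddCommGroup M] [NormedSpace ℂ M] (n : ℕ) :=
  ContinuousMultilinearMap ℂ (fun _ : Fin n => A) M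

namespace Hochschild

/-- The value `(δF)(a₁, …, aₙ₊₁)` of the Hochschild coboundary. The argument of the middle terms
is `(a₁, …, aⱼaⱼ₊₁, …, aₙ₊₁)`; the index `j` of the code starts at `0`, that of the formula
at `1`. -/
def coboundaryFun (X : BanachBimodule A M) {n : ℕ} (F : HochschildCochain A M n)
    (a : Fin (n + 1) → A) : M :=
  X.left (a 0) (F (Fin.tail a))
    + ∑ j : Fin n, (-1 : ℂ) ^ ((j : ℕ) + 1) • F (Fin.contractNth j.castSucc (· * ·) a)
    + (-1 : ℂ) ^ (n + 1) • X.right (a (Fin.last n)) (F (Fin.init a))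

theorem exists_contractNth_update [IsScalarTower ℂ A A] [SMulCommClass ℂ A A] {n : ℕ}
    (j : Fin n) (a : Fin (n + 1) → A) (i : Fin (n + 1)) :
    ∃ (k : Fin n) (φ : A →ₗ[ℂ] A), ∀ x,
      Fin.contractNth j.castSucc (· * ·) (Function.update a i x)
        = Function.update (Fin.contractNth j.castSucc (· * ·) a) k (φ x) := by
  rcases lt_trichotomy (i : ℕ) j with h | h | h
  · refine ⟨⟨i, by omega⟩, LinearMap.id, fun x => ?_⟩
    ext k
    simp only [Fin.contractNth, Function.update_apply, Fin.ext_iff, Fin.val_castSucc, Fin.val_succ,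
      LinearMap.id_apply]
    grind
  · refine ⟨j, LinearMap.mulRight ℂ (a j.succ), fun x => ?_⟩
    ext k
    simp only [Fin.contractNth, Function.update_apply, Fin.ext_iff, Fin.val_castSucc, Fin.val_succ,
      LinearMap.mulRight_apply]
    grind
  · rcases Nat.lt_or_ge ((j : ℕ) + 1) i with h' | h'
    · refine ⟨⟨i - 1, by omega⟩, LinearMap.id, fun x => ?_⟩
      ext k
      simp only [Fin.contractNth, Function.update_apply, Fin.ext_iff, Fin.val_castSucc,
        Fin.val_succ, LinearMap.id_apply]
      grind
    · refine ⟨j, LinearMap.mulLeft ℂ (a j.castSucc), fun x => ?_⟩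
      ext k
      simp only [Fin.contractNth, Function.update_apply, Fin.ext_iff, Fin.val_castSucc,
        Fin.val_succ, LinearMap.mulLeft_apply]
      grind

theorem exists_left_update (X : BanachBimodule A M) {n : ℕ} (F : HochschildCochain A M n)
    (a : Fin (n + 1) → A) (i : Fin (n + 1)) :
    ∃ φ : A →ₗ[ℂ] M, ∀ x,
      X.left (Function.update a i x 0) (F (Fin.tail (Function.update a i x))) = φ x := by
  induction i using Fin.cases with
  | zero =>
    exact ⟨(X.left.flip (F (Fin.tail a))).toLinearMap, fun x => by simp⟩
  | succ k =>
    refine ⟨(X.left (a 0)).toLinearMap ∘ₗ F.toMultilinearMap.toLinearMap (Fin.tail a) k,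
      fun x => ?_⟩
    rw [Fin.tail_update_succ, Function.update_of_ne (Fin.succ_ne_zero k).symm]
    simp

theorem exists_right_update (X : BanachBimodule A M) {n : ℕ} (F : HochschildCochain A M n)
    (a : Fin (n + 1) → A) (i : Fin (n + 1)) :
    ∃ φ : A →ₗ[ℂ] M, ∀ x,
      X.right (Function.update a i x (Fin.last n)) (F (Fin.init (Function.update a i x)))
        = φ x := by
  induction i using Fin.lastCases with
  | last =>
    exact ⟨(X.right.flip (F (Fin.init a))).toLinearMap, fun x => by simp⟩
  | cast k =>
    refine ⟨(X.right (a (Fin.last n))).toLinearMap ∘ₗ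
      F.toMultilinearMap.toLinearMap (Fin.init a) k, fun x => ?_⟩
    rw [Fin.init_update_castSucc, Function.update_of_ne (Fin.castSucc_lt_last k).ne']
    simp

theorem continuous_coboundaryFun (X : BanachBimodule A M) {n : ℕ}
    (F : HochschildCochain A M n) : Continuous (coboundaryFun X F) := by
  have hc : ∀ j : Fin n, Continuous fun a : Fin (n + 1) → A =>
      Fin.contractNth j.castSucc (· * ·) a := by
    intro j
    refine continuous_pi fun k => ?_
    unfold Fin.contractNth
    split_ifs <;> fun_prop
  have hl : Continuous fun a : Fin (n + 1) → A => F (Fin.tail a) :=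
    F.cont.comp (by unfold Fin.tail; fun_prop)
  have hr : Continuous fun a : Fin (n + 1) → A => F (Fin.init a) :=
    F.cont.comp (by unfold Fin.init; fun_prop)
  refine ((?_ : Continuous _).add ?_).add ?_
  · exact (X.left.continuous.comp (continuous_apply 0)).clm_apply hl
  · exact continuous_finsetSum _ fun j _ => (F.cont.comp (hc j)).const_smul _
  · exact ((X.right.continuous.comp (continuous_apply (Fin.last n))).clm_apply hr).const_smul _

variable [IsScalarTower ℂ A A] [SMulCommClass ℂ A A]

theorem exists_coboundaryFun_update (X : BanachBimodule A M) {n : ℕ}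
    (F : HochschildCochain A M n) (a : Fin (n + 1) → A) (i : Fin (n + 1)) :
    ∃ φ : A →ₗ[ℂ] M, ∀ x, coboundaryFun X F (Function.update a i x) = φ x := by
  obtain ⟨φ, hφ⟩ := exists_left_update X F a i
  obtain ⟨ψ, hψ⟩ := exists_right_update X F a i
  choose k χ hχ using fun j : Fin n => exists_contractNth_update j a i
  refine ⟨φ + ∑ j : Fin n, (-1 : ℂ) ^ ((j : ℕ) + 1) •
    (F.toMultilinearMap.toLinearMap (Fin.contractNth j.castSucc (· * ·) a) (k j) ∘ₗ χ j)
      + (-1 : ℂ) ^ (n + 1) • ψ, fun x => ?_⟩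
  simp [coboundaryFun, hφ, hψ, hχ]

/-- The Hochschild coboundary operator `δₙ : Cⁿ(A, M) → Cⁿ⁺¹(A, M)`. -/
def coboundary (X : BanachBimodule A M) (n : ℕ) :
    HochschildCochain A M n →ₗ[ℂ] HochschildCochain A M (n + 1) where
  toFun F :=
    { MultilinearMap.mk' (coboundaryFun X F)
        (fun a i x y => by
          obtain ⟨φ, hφ⟩ := exists_coboundaryFun_update X F a i
          simp only [hφ, map_add])
        (fun a i c x => by
          obtain ⟨φ, hφ⟩ := exists_coboundaryFun_update X F a i
          simp only [hφ, map_smul]) with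
      cont := continuous_coboundaryFun X F }
  map_add' F G := by
    ext a
    change coboundaryFun X (F + G) a = coboundaryFun X F a + coboundaryFun X G a
    simp only [coboundaryFun, add_apply, map_add, smul_add,
      Finset.sum_add_distrib]
    abel
  map_smul' c F := by
    ext a
    change coboundaryFun X (c • F) a = c • coboundaryFun X F a
    simp only [coboundaryFun, smul_apply, map_smul, smul_add,
      Finset.smul_sum, smul_comm c]

theorem coboundary_apply (X : BanachBimodule A M) (n : ℕ) (F : HochschildCochain A M n)
    (a : Fin (n + 1) → A) :
    coboundary X n F a =
      X.left (a 0) (F (Fin.tail a))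
        + ∑ j : Fin n, (-1 : ℂ) ^ ((j : ℕ) + 1) • F (Fin.contractNth j.castSucc (· * ·) a)
        + (-1 : ℂ) ^ (n + 1) • X.right (a (Fin.last n)) (F (Fin.init a)) := rfl

/-- The `n`-cocycles, `ker δₙ`. -/
def cocycles (X : BanachBimodule A M) (n : ℕ) : Submodule ℂ (HochschildCochain A M n) :=
  LinearMap.ker (coboundary X n)

/-- The `n`-coboundaries, `im δₙ₋₁` (zero for `n = 0`). -/
def coboundaries (X : BanachBimodule A M) : (n : ℕ) → Submodule ℂ (HochschildCochain A M n)
  | 0 => ⊥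
  | n + 1 => LinearMap.range (coboundary X n)

/-- The continuous Hochschild cohomology group `Hⁿ(A, M) = ker δₙ / im δₙ₋₁`. -/
abbrev Cohomology (X : BanachBimodule A M) (n : ℕ) :=
  cocycles X n ⧸ (coboundaries X n).submoduleOf (cocycles X n)

end Hochschild

end Hochschild

end

noncomputable section

/-! Restricted to point masses, a Hochschild cochain becomes a bounded function `F : Sⁿ → M`, and
every such function arises in this way. Hence it suffices to find, on the complex of functions,
a homotopy `h` with `h δ + δ h = 1` in positive degrees that preserves boundedness.

Over the finite semilattice generated by a list `l`, the element
`∏_{s ∈ l} (s ⊗ s + (1 - s) ⊗ (1 - s))` is a separability idempotent. Contracting the first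
variable of a cochain against it gives an operator `K l` with `K l δ F = F - δ (K l F)` on tuples
from that semilattice, but there is no such operator for all of `S` at once. The operators `K l`
are therefore glued: `h F` is defined recursively by `(h F)(s) = (K l F - δ h (K l F))(s)`, where
`l` lists the entries of the tuple `s` and the correction term makes up for the dependence of `l`
on `s`. The bound is uniform since `l` has as many entries as `s`. -/

namespace SemigroupCochain

variable {R S M : Type*} [CommRing R]

theorem init_cons {n : ℕ} (s : S) (a : Fin (n + 1) → S) :
    Fin.init (Fin.cons s a : Fin (n + 2) → S) = Fin.cons s (Fin.init a) := by
  ext k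
  cases k using Fin.cases <;> simp [Fin.init]

section Coboundary

variable [AddCommGroup M] [Module R M]

section Mul

variable [Mul S] (ρ : S →ₙ* Module.End R M) {n : ℕ}

theorem map_mul_apply (s t : S) (x : M) : ρ (s * t) x = ρ s (ρ t x) := by
  rw [map_mul, Module.End.mul_apply]

/-- The term of the coboundary `δ` that involves the action on the left. -/
def leftCoboundary (n : ℕ) : ((Fin n → S) → M) →ₗ[R] ((Fin (n + 1) → S) → M) :=
  LinearMap.pi fun a => ρ (a 0) ∘ₗ LinearMap.proj (Fin.tail a)

/-- The remaining terms of the coboundary, with the opposite sign. Up to sign, this is the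
coboundary for the bimodule with zero left action and right action `ρ`. -/
def rightCoboundary (n : ℕ) : ((Fin n → S) → M) →ₗ[R] ((Fin (n + 1) → S) → M) :=
  LinearMap.pi fun a =>
    ∑ j : Fin n, (-1 : R) ^ (j : ℕ) • LinearMap.proj (Fin.contractNth j.castSucc (· * ·) a)
      + (-1 : R) ^ n • ρ (a (Fin.last n)) ∘ₗ LinearMap.proj (Fin.init a)

/-- The Hochschild coboundary of functions `Sⁿ → M` with values in a symmetric bimodule, on both
sides of which `S` acts by `ρ`. -/
def coboundary (n : ℕ) : ((Fin n → S) → M) →ₗ[R] ((Fin (n + 1) → S) → M) :=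
  leftCoboundary ρ n - rightCoboundary ρ n

theorem leftCoboundary_apply (F : (Fin n → S) → M) (a : Fin (n + 1) → S) :
    leftCoboundary ρ n F a = ρ (a 0) (F (Fin.tail a)) := rfl

theorem rightCoboundary_apply (F : (Fin n → S) → M) (a : Fin (n + 1) → S) :
    rightCoboundary ρ n F a
      = ∑ j : Fin n, (-1 : R) ^ (j : ℕ) • F (Fin.contractNth j.castSucc (· * ·) a)
        + (-1 : R) ^ n • ρ (a (Fin.last n)) (F (Fin.init a)) := by
  simp [rightCoboundary]

theorem coboundary_apply (F : (Fin n → S) → M) (a : Fin (n + 1) → S) :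
    coboundary ρ n F a = ρ (a 0) (F (Fin.tail a))
      + ∑ j : Fin n, (-1 : R) ^ ((j : ℕ) + 1) • F (Fin.contractNth j.castSucc (· * ·) a)
      + (-1 : R) ^ (n + 1) • ρ (a (Fin.last n)) (F (Fin.init a)) := by
  simp only [coboundary, LinearMap.sub_apply, Pi.sub_apply, leftCoboundary_apply,
    rightCoboundary_apply, pow_succ, mul_neg_one, neg_smul, Finset.sum_neg_distrib]
  abel

theorem contractNth_zero_cons (s : S) (a : Fin (n + 1) → S) :
    Fin.contractNth (0 : Fin (n + 2)) (· * ·) (Fin.cons s a : Fin (n + 2) → S)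
      = Fin.cons (s * a 0) (Fin.tail a) := by
  ext k
  cases k using Fin.cases <;> simp [Fin.contractNth, Fin.tail]

theorem contractNth_succ_cons (j : Fin (n + 1)) (s : S) (a : Fin (n + 1) → S) :
    Fin.contractNth j.succ (· * ·) (Fin.cons s a : Fin (n + 2) → S)
      = Fin.cons s (Fin.contractNth j (· * ·) a) := by
  ext k
  cases k using Fin.cases <;> simp [Fin.contractNth]

theorem rightCoboundary_cons (F : (Fin (n + 1) → S) → M) (s : S) (a : Fin (n + 1) → S) :
    rightCoboundary ρ (n + 1) F (Fin.cons s a)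
      = F (Fin.cons (s * a 0) (Fin.tail a))
        - rightCoboundary ρ n (fun b => F (Fin.cons s b)) a := by
  have hlast : (Fin.cons s a : Fin (n + 2) → S) (Fin.last (n + 1)) = a (Fin.last n) := rfl
  simp only [rightCoboundary_apply, Fin.sum_univ_succ, Fin.castSucc_zero, ← Fin.succ_castSucc,
    contractNth_zero_cons, contractNth_succ_cons, init_cons, hlast, Fin.val_zero, Fin.val_succ,
    pow_zero, one_smul, pow_succ, mul_neg_one, neg_smul, Finset.sum_neg_distrib]
  abel

theorem coboundary_cons (F : (Fin (n + 1) → S) → M) (s : S) (a : Fin (n + 1) → S) :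
    coboundary ρ (n + 1) F (Fin.cons s a)
      = ρ s (F a) - F (Fin.cons (s * a 0) (Fin.tail a))
        + rightCoboundary ρ n (fun b => F (Fin.cons s b)) a := by
  simp only [coboundary, LinearMap.sub_apply, Pi.sub_apply, leftCoboundary_apply,
    rightCoboundary_cons, Fin.cons_zero, Fin.tail_cons]
  abel

theorem coboundary_zero (F : (Fin 0 → S) → M) : coboundary ρ 0 F = 0 := by
  ext a
  rw [coboundary_apply, Subsingleton.elim (Fin.tail a) (Fin.init a)]
  simp

theorem contractNth_mem {T : Subsemigroup S} (j : Fin (n + 1)) {a : Fin (n + 1) → S}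
    (ha : ∀ i, a i ∈ T) (k : Fin n) : Fin.contractNth j (· * ·) a k ∈ T := by
  unfold Fin.contractNth
  split_ifs
  exacts [ha _, T.mul_mem (ha _) (ha _), ha _]

theorem coboundary_eqOn {T : Subsemigroup S} {F G : (Fin n → S) → M}
    (h : Set.EqOn F G {a | ∀ i, a i ∈ T}) :
    Set.EqOn (coboundary ρ n F) (coboundary ρ n G) {a | ∀ i, a i ∈ T} := by
  intro a ha
  have hinit : F (Fin.init a) = G (Fin.init a) := h fun i => ha i.castSucc
  have htail : F (Fin.tail a) = G (Fin.tail a) := h fun i => ha i.succ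
  simp only [coboundary_apply, hinit, htail, h (contractNth_mem _ ha)]

end Mul

variable [CommSemigroup S] (ρ : S →ₙ* Module.End R M) {n : ℕ}

theorem rightCoboundary_act (s : S) (F : (Fin n → S) → M) (a : Fin (n + 1) → S) :
    rightCoboundary ρ n (fun b => ρ s (F b)) a = ρ s (rightCoboundary ρ n F a) := by
  simp only [rightCoboundary_apply, map_add, map_sum, map_smul, ← map_mul_apply, mul_comm s]

theorem rightCoboundary_rightCoboundary (F : (Fin n → S) → M) :
    rightCoboundary ρ (n + 1) (rightCoboundary ρ n F) = 0 := by
  induction n with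
  | zero =>
    ext a
    cases a using Fin.consCases with | _ s a =>
    have hF : ∀ b : Fin 0 → S, F b = F default := fun b => congrArg F (Subsingleton.elim b _)
    rw [rightCoboundary_cons]
    simp [rightCoboundary_apply, hF, Fin.last, mul_comm s]
  | succ n ih =>
    ext a
    cases a using Fin.consCases with | _ s a =>
    cases a using Fin.consCases with | _ t b =>
    have hs : (fun a => rightCoboundary ρ (n + 1) F (Fin.cons s a))
        = (fun a => F (Fin.cons (s * a 0) (Fin.tail a)))
          - rightCoboundary ρ n fun a => F (Fin.cons s a) :=
      funext fun a => rightCoboundary_cons ρ F s a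
    rw [rightCoboundary_cons, hs, map_sub, ih, sub_zero]
    simp only [rightCoboundary_cons, Fin.cons_zero, Fin.tail_cons, mul_assoc, Pi.zero_apply,
      sub_self]

theorem rightCoboundary_leftCoboundary (F : (Fin n → S) → M) :
    rightCoboundary ρ (n + 1) (leftCoboundary ρ n F)
      = leftCoboundary ρ (n + 1) (coboundary ρ n F) := by
  ext a
  cases a using Fin.consCases with | _ s a =>
  simp only [rightCoboundary_cons, leftCoboundary_apply, Fin.cons_zero, Fin.tail_cons,
    rightCoboundary_act, coboundary, LinearMap.sub_apply, Pi.sub_apply, map_sub, map_mul_apply]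

theorem coboundary_coboundary (F : (Fin n → S) → M) :
    coboundary ρ (n + 1) (coboundary ρ n F) = 0 :=
  calc coboundary ρ (n + 1) (coboundary ρ n F)
      = leftCoboundary ρ (n + 1) (coboundary ρ n F)
        - rightCoboundary ρ (n + 1) (leftCoboundary ρ n F - rightCoboundary ρ n F) := rfl
    _ = 0 := by
      rw [map_sub, rightCoboundary_leftCoboundary, rightCoboundary_rightCoboundary, sub_zero,
        sub_self]

end Coboundary

section Diagonal

theorem mul_diagonal_eq {A : Type*} [Ring A] {p q : A} (hp : IsIdempotentElem p)
    (hq : IsIdempotentElem q) (hpq : Commute p q) :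
    p * (p * q + (1 - p) * (1 - q)) = q * (p * q + (1 - p) * (1 - q)) := by
  have hleft : p * (p * q + (1 - p) * (1 - q)) = p * q := by
    rw [mul_add, ← mul_assoc, hp.eq, ← mul_assoc, hp.mul_one_sub_self, zero_mul, add_zero]
  have hright : q * (p * q + (1 - p) * (1 - q)) = p * q := by
    have hcomm : Commute q (1 - p) := (Commute.one_right q).sub_right hpq.symm
    rw [mul_add, hpq.symm.left_comm, hq.eq, hcomm.left_comm, hq.mul_one_sub_self, mul_zero,
      add_zero]
  rw [hleft, hright]

theorem commute_diagonal {A : Type*} [Ring A] {x p q : A} (hp : Commute x p) (hq : Commute x q) :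
    Commute x (p * q + (1 - p) * (1 - q)) :=
  (hp.mul_right hq).add_right
    (((Commute.one_right x).sub_right hp).mul_right ((Commute.one_right x).sub_right hq))

variable [AddCommGroup M] [Module R M]

variable (R S M) in
/-- Extension of functions on `S` by zero to an adjoined identity, which makes it possible to
contract a function on `S` by evaluation at the identity. -/
def extendZero : (S → M) →ₗ[R] (WithOne S → M) :=
  LinearMap.pi (WithOne.recOneCoe 0 LinearMap.proj)

section Mul

variable [Mul S] (ρ : S →ₙ* Module.End R M)

/-- The pointwise action of `S` on the functions on `S` with an identity adjoined. -/
def act : S →ₙ* Module.End R (WithOne S → M) where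
  toFun s := (ρ s).compLeft (WithOne S)
  map_mul' s t := by
    ext Φ u
    simp

theorem act_apply (s : S) (Φ : WithOne S → M) (u : WithOne S) : act ρ s Φ u = ρ s (Φ u) := rfl

end Mul

variable [CommSemigroup S] (ρ : S →ₙ* Module.End R M)

variable (R S M) in
/-- The action of `S` by translation on the functions on `S` with an identity adjoined. -/
def translate : S →ₙ* Module.End R (WithOne S → M) where
  toFun s := LinearMap.funLeft R M ((s : WithOne S) * ·)
  map_mul' s t := by
    ext Φ u
    simp [LinearMap.funLeft_apply, mul_left_comm, mul_assoc]

/-- The action of `s ⊗ s + (1 - s) ⊗ (1 - s)` on functions, where the first tensor factor acts by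
translation and the second one pointwise. -/
def diagonal (s : S) : Module.End R (WithOne S → M) :=
  translate R S M s * act ρ s + (1 - translate R S M s) * (1 - act ρ s)

/-- The action of the separability idempotent `∏_{s ∈ l} (s ⊗ s + (1 - s) ⊗ (1 - s))`. -/
def diagonalProd (l : List S) : Module.End R (WithOne S → M) :=
  (l.map (diagonal ρ)).prod

theorem translate_apply (s : S) (Φ : WithOne S → M) (u : WithOne S) :
    translate R S M s Φ u = Φ (s * u) := rfl

theorem commute_translate_act (s t : S) : Commute (translate R S M s) (act ρ t) := by
  ext Φ u
  rfl

theorem commute_translate_diagonal (s t : S) : Commute (translate R S M s) (diagonal ρ t) :=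
  commute_diagonal ((Commute.all s t).map _) (commute_translate_act ρ s t)

theorem commute_act_diagonal (s t : S) : Commute (act ρ s) (diagonal ρ t) :=
  commute_diagonal (commute_translate_act ρ t s).symm ((Commute.all s t).map _)

theorem commute_translate_diagonalProd (s : S) (l : List S) :
    Commute (translate R S M s) (diagonalProd ρ l) :=
  Commute.list_prod_right _ _ (List.forall_mem_map.2 fun t _ => commute_translate_diagonal ρ s t)

theorem commute_act_diagonalProd (s : S) (l : List S) :
    Commute (act ρ s) (diagonalProd ρ l) :=
  Commute.list_prod_right _ _ (List.forall_mem_map.2 fun t _ => commute_act_diagonal ρ s t)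

theorem diagonalProd_cons (s : S) (l : List S) :
    diagonalProd ρ (s :: l) = diagonal ρ s * diagonalProd ρ l := by
  rw [diagonalProd, List.map_cons, List.prod_cons, diagonalProd]

section Idempotent

variable (hS : ∀ s : S, IsIdempotentElem s)
include hS

theorem translate_mul_diagonal_self (s : S) :
    translate R S M s * diagonal ρ s = act ρ s * diagonal ρ s :=
  mul_diagonal_eq ((hS s).map _) ((hS s).map _) (commute_translate_act ρ s s)

theorem translate_mul_diagonalProd_of_mem {l : List S} {s : S} (hs : s ∈ l) :
    translate R S M s * diagonalProd ρ l = act ρ s * diagonalProd ρ l := by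
  induction l with
  | nil => cases hs
  | cons t l ih =>
    rw [diagonalProd_cons]
    rcases List.mem_cons.1 hs with rfl | hs
    · rw [← mul_assoc, translate_mul_diagonal_self ρ hS, mul_assoc]
    · rw [(commute_translate_diagonal ρ s t).left_comm, ih hs,
        (commute_act_diagonal ρ s t).left_comm]

theorem translate_mul_diagonalProd {l : List S} {a : S}
    (ha : a ∈ Subsemigroup.closure {s | s ∈ l}) :
    translate R S M a * diagonalProd ρ l = act ρ a * diagonalProd ρ l := by
  induction ha using Subsemigroup.closure_induction with
  | mem a ha => exact translate_mul_diagonalProd_of_mem ρ hS ha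
  | mul a b _ _ iha ihb =>
    rw [map_mul, map_mul, mul_assoc, ihb, (commute_translate_act ρ a b).left_comm, iha,
      ← mul_assoc, ((Commute.all b a).map (act ρ)).eq]

theorem diagonalProd_orbit (l : List S) (x : M) :
    diagonalProd ρ l (fun u => WithOne.lift ρ u x) = fun u => WithOne.lift ρ u x := by
  induction l with
  | nil => rfl
  | cons s l ih =>
    have htranslate : translate R S M s (fun u => WithOne.lift ρ u x)
        = act ρ s fun u => WithOne.lift ρ u x := by
      ext u
      simp [translate_apply, act_apply]
    have hidem : ∀ Φ, act ρ s (act ρ s Φ) = act ρ s Φ := fun Φ => by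
      rw [← Module.End.mul_apply, ((hS s).map (act ρ)).eq]
    have hcomm : ∀ Φ, translate R S M s (act ρ s Φ) = act ρ s (translate R S M s Φ) := fun _ => rfl
    rw [diagonalProd_cons, Module.End.mul_apply, ih]
    simp only [diagonal, LinearMap.add_apply, LinearMap.sub_apply, Module.End.mul_apply,
      Module.End.one_apply, map_sub, hcomm, htranslate, hidem]
    abel

end Idempotent

end Diagonal

section Contraction

variable [AddCommGroup M] [Module R M] [CommSemigroup S] (ρ : S →ₙ* Module.End R M)

/-- The contraction of a function on `S` against the separability idempotent of `l`. -/
def contract (l : List S) : (S → M) →ₗ[R] M :=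
  LinearMap.proj 1 ∘ₗ diagonalProd ρ l ∘ₗ extendZero R S M

theorem contract_apply (l : List S) (φ : S → M) :
    contract ρ l φ = diagonalProd ρ l (extendZero R S M φ) 1 := rfl

theorem contract_act (l : List S) (a : S) (φ : S → M) :
    contract ρ l (fun s => ρ a (φ s)) = ρ a (contract ρ l φ) := by
  have hext : extendZero R S M (fun s => ρ a (φ s)) = act ρ a (extendZero R S M φ) := by
    ext u
    cases u <;> simp [extendZero, act_apply]
  rw [contract_apply, hext, ← Module.End.mul_apply, ← (commute_act_diagonalProd ρ a l).eq]
  rfl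

theorem contract_act_sub_translate (hS : ∀ s : S, IsIdempotentElem s) {l : List S} {a : S}
    (ha : a ∈ Subsemigroup.closure {s | s ∈ l}) (φ : S → M) :
    contract ρ l (fun s => ρ s (φ a) - φ (s * a)) = φ a - ρ a (contract ρ l φ) := by
  let Φ := extendZero R S M φ
  have hext : extendZero R S M (fun s => ρ s (φ a) - φ (s * a))
      = (fun u => WithOne.lift ρ u (φ a)) - translate R S M a Φ := by
    ext u
    cases u <;> simp [Φ, extendZero, translate_apply, ← WithOne.coe_mul, mul_comm a]
  have htranslate : diagonalProd ρ l (translate R S M a Φ) = act ρ a (diagonalProd ρ l Φ) := by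
    rw [← Module.End.mul_apply, ← (commute_translate_diagonalProd ρ a l).eq,
      translate_mul_diagonalProd ρ hS ha, Module.End.mul_apply]
  rw [contract_apply, hext, map_sub, diagonalProd_orbit ρ hS, htranslate]
  simp [Φ, contract_apply, act_apply]

/-- Contraction of the first variable of a cochain against the separability idempotent of `l`. -/
def contractFirst (l : List S) (n : ℕ) : ((Fin (n + 1) → S) → M) →ₗ[R] ((Fin n → S) → M) :=
  LinearMap.pi fun a => contract ρ l ∘ₗ LinearMap.pi fun s => LinearMap.proj (Fin.cons s a)

theorem contractFirst_apply (l : List S) {n : ℕ} (F : (Fin (n + 1) → S) → M) (a : Fin n → S) :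
    contractFirst ρ l n F a = contract ρ l fun s => F (Fin.cons s a) := rfl

theorem contract_rightCoboundary (l : List S) {n : ℕ} (F : (Fin (n + 1) → S) → M)
    (a : Fin (n + 1) → S) :
    contract ρ l (fun s => rightCoboundary ρ n (fun b => F (Fin.cons s b)) a)
      = rightCoboundary ρ n (contractFirst ρ l n F) a := by
  have hsum : (fun s => rightCoboundary ρ n (fun b => F (Fin.cons s b)) a)
      = ∑ j : Fin n, (-1 : R) ^ (j : ℕ) •
          (fun s => F (Fin.cons s (Fin.contractNth j.castSucc (· * ·) a)))
        + (-1 : R) ^ n • fun s => ρ (a (Fin.last n)) (F (Fin.cons s (Fin.init a))) := by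
    ext s
    simp [rightCoboundary_apply]
  rw [hsum, map_add, map_sum, rightCoboundary_apply]
  simp only [map_smul, contract_act, contractFirst_apply]

theorem contractFirst_coboundary (hS : ∀ s : S, IsIdempotentElem s) {l : List S} {n : ℕ}
    (F : (Fin (n + 1) → S) → M) {a : Fin (n + 1) → S}
    (ha : a 0 ∈ Subsemigroup.closure {s | s ∈ l}) :
    contractFirst ρ l (n + 1) (coboundary ρ (n + 1) F) a
      = F a - coboundary ρ n (contractFirst ρ l n F) a := by
  have hleft : contract ρ l (fun s => ρ s (F a) - F (Fin.cons (s * a 0) (Fin.tail a)))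
      = F a - ρ (a 0) (contractFirst ρ l n F (Fin.tail a)) := by
    simpa only [Fin.cons_self_tail, contractFirst_apply] using
      contract_act_sub_translate ρ hS ha fun s => F (Fin.cons s (Fin.tail a))
  calc contractFirst ρ l (n + 1) (coboundary ρ (n + 1) F) a
      = contract ρ l ((fun s => ρ s (F a) - F (Fin.cons (s * a 0) (Fin.tail a)))
          + fun s => rightCoboundary ρ n (fun b => F (Fin.cons s b)) a) :=
        congrArg (contract ρ l) (funext fun s => coboundary_cons ρ F s a)
    _ = (F a - leftCoboundary ρ n (contractFirst ρ l n F) a)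
          + rightCoboundary ρ n (contractFirst ρ l n F) a := by
        rw [map_add, hleft, contract_rightCoboundary, leftCoboundary_apply]
    _ = F a - coboundary ρ n (contractFirst ρ l n F) a := by
        rw [coboundary, LinearMap.sub_apply, Pi.sub_apply]
        abel

end Contraction

section Homotopy

variable [AddCommGroup M] [Module R M] [CommSemigroup S] (ρ : S →ₙ* Module.End R M)

/-- The contracting homotopy `h` of the complex of functions `Sⁿ → M`, given at a tuple `s` by
`K - δ h K`, where `K` is the contraction against the separability idempotent of the entries
of `s`. In degree `n`, it maps functions of `n + 1` variables to functions of `n` variables. -/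
def homotopy : (n : ℕ) → ((Fin (n + 1) → S) → M) →ₗ[R] ((Fin n → S) → M)
  | 0 => 0
  | n + 1 => LinearMap.pi fun s => LinearMap.proj s ∘ₗ
      (LinearMap.id - coboundary ρ n ∘ₗ homotopy n) ∘ₗ contractFirst ρ (List.ofFn s) (n + 1)

theorem homotopy_succ_apply {n : ℕ} (F : (Fin (n + 2) → S) → M) (s : Fin (n + 1) → S) :
    homotopy ρ (n + 1) F s = contractFirst ρ (List.ofFn s) (n + 1) F s
      - coboundary ρ n (homotopy ρ n (contractFirst ρ (List.ofFn s) (n + 1) F)) s := rfl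

theorem diagonalProd_eqOn {l : List S} {U : Set (WithOne S)}
    (hU : ∀ s ∈ l, ∀ u ∈ U, ↑s * u ∈ U) {Φ Ψ : WithOne S → M} (h : Set.EqOn Φ Ψ U) :
    Set.EqOn (diagonalProd ρ l Φ) (diagonalProd ρ l Ψ) U := by
  induction l with
  | nil => exact h
  | cons s l ih =>
    have ih := ih fun t ht => hU t (List.mem_cons_of_mem s ht)
    intro u hu
    have hsu : ↑s * u ∈ U := hU s List.mem_cons_self u hu
    simp only [diagonalProd_cons, diagonal, Module.End.mul_apply, LinearMap.add_apply,
      LinearMap.sub_apply, Module.End.one_apply, Pi.add_apply, Pi.sub_apply, translate_apply,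
      act_apply, ih hu, ih hsu]

theorem contract_congr {l : List S} {T : Subsemigroup S} (hl : ∀ s ∈ l, s ∈ T) {φ ψ : S → M}
    (h : Set.EqOn φ ψ T) : contract ρ l φ = contract ρ l ψ := by
  let U : Set (WithOne S) := insert 1 ((↑) '' (T : Set S))
  have hU : ∀ s ∈ l, ∀ u ∈ U, ↑s * u ∈ U := by
    rintro s hs _ (rfl | ⟨t, ht, rfl⟩)
    · exact Or.inr ⟨s, hl s hs, (mul_one _).symm⟩
    · exact Or.inr ⟨s * t, T.mul_mem (hl s hs) ht, WithOne.coe_mul s t⟩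
  have hext : Set.EqOn (extendZero R S M φ) (extendZero R S M ψ) U := by
    rintro _ (rfl | ⟨t, ht, rfl⟩)
    · rfl
    · exact h ht
  exact diagonalProd_eqOn ρ hU hext (Set.mem_insert _ _)

theorem contractFirst_eqOn {l : List S} {T : Subsemigroup S} (hl : ∀ s ∈ l, s ∈ T) {n : ℕ}
    {F G : (Fin (n + 1) → S) → M} (h : Set.EqOn F G {a | ∀ i, a i ∈ T}) :
    Set.EqOn (contractFirst ρ l n F) (contractFirst ρ l n G) {a | ∀ i, a i ∈ T} :=
  fun _ ha => contract_congr ρ hl fun _ hs => h (Fin.cases hs ha)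

theorem homotopy_eqOn {T : Subsemigroup S} {n : ℕ} {F G : (Fin (n + 1) → S) → M}
    (h : Set.EqOn F G {a | ∀ i, a i ∈ T}) :
    Set.EqOn (homotopy ρ n F) (homotopy ρ n G) {a | ∀ i, a i ∈ T} := by
  induction n with
  | zero => exact fun _ _ => rfl
  | succ n ih =>
    intro s hs
    have hK := contractFirst_eqOn ρ (List.forall_mem_ofFn_iff.2 hs) h
    rw [homotopy_succ_apply, homotopy_succ_apply, hK hs, coboundary_eqOn ρ (ih hK) hs]

theorem homotopy_coboundary (hS : ∀ s : S, IsIdempotentElem s) {n : ℕ}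
    (F : (Fin (n + 1) → S) → M) :
    homotopy ρ (n + 1) (coboundary ρ (n + 1) F) = F - coboundary ρ n (homotopy ρ n F) := by
  induction n with
  | zero =>
    ext s
    have hs : s 0 ∈ Subsemigroup.closure {t | t ∈ List.ofFn s} :=
      Subsemigroup.subset_closure (List.mem_ofFn.2 ⟨0, rfl⟩)
    simp only [homotopy_succ_apply, contractFirst_coboundary ρ hS F hs, coboundary_zero, sub_zero,
      Pi.zero_apply, Pi.sub_apply]
  | succ n ih =>
    ext s
    let T := Subsemigroup.closure {t | t ∈ List.ofFn s}
    have hs : ∀ i, s i ∈ T := fun i => Subsemigroup.subset_closure (List.mem_ofFn.2 ⟨i, rfl⟩)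
    let K := contractFirst ρ (List.ofFn s)
    let G := K (n + 1) F
    have hK : Set.EqOn (K (n + 2) (coboundary ρ (n + 2) F)) (F - coboundary ρ (n + 1) G)
        {a | ∀ i, a i ∈ T} := fun a ha => contractFirst_coboundary ρ hS F (ha 0)
    have hδG : coboundary ρ (n + 1) (homotopy ρ (n + 1) (coboundary ρ (n + 1) G))
        = coboundary ρ (n + 1) G := by
      rw [ih, map_sub, coboundary_coboundary, sub_zero]
    calc homotopy ρ (n + 2) (coboundary ρ (n + 2) F) s
        = (F - coboundary ρ (n + 1) G) s
          - coboundary ρ (n + 1) (homotopy ρ (n + 1) (F - coboundary ρ (n + 1) G)) s :=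
          congrArg₂ (· - ·) (hK hs) (coboundary_eqOn ρ (homotopy_eqOn ρ hK) hs)
      _ = (F - coboundary ρ (n + 1) (homotopy ρ (n + 1) F)) s := by
          rw [map_sub, map_sub, hδG]
          simp only [Pi.sub_apply]
          abel

end Homotopy

section Bound

variable [SeminormedAddCommGroup M] [Module R M] {C B : ℝ}

theorem norm_coboundary_le [Mul S] (ρ : S →ₙ* Module.End R M) (hC : 0 ≤ C)
    (hρ : ∀ s x, ‖ρ s x‖ ≤ C * ‖x‖) {n : ℕ} {F : (Fin n → S) → M} (hF : ∀ a, ‖F a‖ ≤ B)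
    (a : Fin (n + 1) → S) : ‖coboundary ρ n F a‖ ≤ (n + 2 * C) * B := by
  have hρB : ∀ s b, ‖ρ s (F b)‖ ≤ C * B := fun s b =>
    (hρ s _).trans (mul_le_mul_of_nonneg_left (hF b) hC)
  have hsign : ∀ (i : ℕ) (x : M), ‖(-1 : R) ^ i • x‖ = ‖x‖ := fun i x => by
    rcases neg_one_pow_eq_or R i with h | h <;> simp [h]
  have hsum : ‖∑ j : Fin n, (-1 : R) ^ ((j : ℕ) + 1) •
      F (Fin.contractNth j.castSucc (· * ·) a)‖ ≤ n * B := by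
    refine (norm_sum_le_of_le Finset.univ fun j _ => (hsign _ _).trans_le (hF _)).trans_eq ?_
    simp
  calc ‖coboundary ρ n F a‖ ≤ C * B + n * B + C * B := by
        rw [coboundary_apply]
        exact norm_add_le_of_le (norm_add_le_of_le (hρB _ _) hsum)
          ((hsign _ _).trans_le (hρB _ _))
    _ = (n + 2 * C) * B := by ring

variable [CommSemigroup S] (ρ : S →ₙ* Module.End R M) (hC : 0 ≤ C)
  (hρ : ∀ s x, ‖ρ s x‖ ≤ C * ‖x‖)
include hC hρ

theorem norm_diagonal_le (s : S) {Φ : WithOne S → M} (hΦ : ∀ u, ‖Φ u‖ ≤ B) (u : WithOne S) :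
    ‖diagonal ρ s Φ u‖ ≤ (2 + 3 * C) * B := by
  have hρB : ∀ {x y}, ‖x‖ ≤ y → ‖ρ s x‖ ≤ C * y := fun hx =>
    (hρ s _).trans (mul_le_mul_of_nonneg_left hx hC)
  calc ‖diagonal ρ s Φ u‖
      = ‖ρ s (Φ (s * u)) + (Φ u - ρ s (Φ u) - (Φ (s * u) - ρ s (Φ (s * u))))‖ := rfl
    _ ≤ C * B + (B + C * B + (B + C * B)) :=
      norm_add_le_of_le (hρB (hΦ _)) (norm_sub_le_of_le
        (norm_sub_le_of_le (hΦ _) (hρB (hΦ _))) (norm_sub_le_of_le (hΦ _) (hρB (hΦ _))))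
    _ = (2 + 3 * C) * B := by ring

theorem norm_diagonalProd_le (l : List S) {Φ : WithOne S → M} (hΦ : ∀ u, ‖Φ u‖ ≤ B)
    (u : WithOne S) : ‖diagonalProd ρ l Φ u‖ ≤ (2 + 3 * C) ^ l.length * B := by
  induction l generalizing u with
  | nil => simpa [diagonalProd] using hΦ u
  | cons s l ih =>
    rw [diagonalProd_cons, Module.End.mul_apply, List.length_cons, pow_succ', mul_assoc]
    exact norm_diagonal_le ρ hC hρ s ih u

theorem norm_contractFirst_le (hB : 0 ≤ B) (l : List S) {n : ℕ} {F : (Fin (n + 1) → S) → M}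
    (hF : ∀ a, ‖F a‖ ≤ B) (a : Fin n → S) :
    ‖contractFirst ρ l n F a‖ ≤ (2 + 3 * C) ^ l.length * B := by
  refine norm_diagonalProd_le ρ hC hρ l (fun u => ?_) 1
  cases u with
  | one => simpa [extendZero] using hB
  | coe s => exact hF (Fin.cons s a)

theorem exists_norm_homotopy_le (n : ℕ) :
    ∃ D : ℝ, 0 ≤ D ∧ ∀ (F : (Fin (n + 1) → S) → M) (B : ℝ), 0 ≤ B → (∀ a, ‖F a‖ ≤ B) →
      ∀ s, ‖homotopy ρ n F s‖ ≤ D * B := by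
  induction n with
  | zero => exact ⟨0, le_rfl, fun F B _ _ s => by simp [homotopy]⟩
  | succ n ih =>
    obtain ⟨D, hD, hhomotopy⟩ := ih
    let E := (2 + 3 * C) ^ (n + 1)
    have hE : 0 ≤ E := by positivity
    refine ⟨E + (n + 2 * C) * (D * E), by positivity, fun F B hB hF s => ?_⟩
    have hK : ∀ a, ‖contractFirst ρ (List.ofFn s) (n + 1) F a‖ ≤ E * B := fun a => by
      simpa [E] using norm_contractFirst_le ρ hC hρ hB (List.ofFn s) hF a
    calc ‖homotopy ρ (n + 1) F s‖ ≤ E * B + (n + 2 * C) * (D * (E * B)) :=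
          norm_sub_le_of_le (hK s)
            (norm_coboundary_le ρ hC hρ (hhomotopy _ _ (mul_nonneg hE hB) hK) s)
      _ = (E + (n + 2 * C) * (D * E)) * B := by ring

end Bound

end SemigroupCochain

namespace EllOne

variable {S : Type*}

open Classical in
/-- The point mass at `s`. The bounded linear maps on `ℓ¹(S)` correspond to the bounded functions
on `S`, by restriction to the point masses. -/
def pointMass (s : S) : EllOne S := lp.single 1 s (1 : ℂ)

theorem norm_pointMass (s : S) : ‖pointMass s‖ = 1 := by
  simp [pointMass, lp.norm_single]

open Classical in
theorem pointMass_apply (s t : S) : pointMass s t = if t = s then 1 else 0 := by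
  simp [pointMass, Pi.single_apply]

theorem pointMass_mul [Semigroup S] (s t : S) :
    pointMass s * pointMass t = pointMass (s * t) := by
  classical
  ext u
  have hterm : ∀ p : S × S, pointMass s p.1 * pointMass t p.2 = if p = (s, t) then 1 else 0 := by
    simp [pointMass_apply, Prod.ext_iff, ← ite_and, and_comm]
  have hmul : (pointMass s * pointMass t) u
      = ∑' p : {p : S × S // p.1 * p.2 = u}, if p.1 = (s, t) then (1 : ℂ) else 0 :=
    tsum_congr fun p => hterm p.1
  rw [hmul, pointMass_apply]
  split_ifs with h
  · subst h
    let e : {p : S × S // p.1 * p.2 = s * t} := ⟨(s, t), rfl⟩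
    exact (tsum_eq_single e fun p hp => if_neg fun h => hp (Subtype.ext h)).trans (if_pos rfl)
  · have hne : ∀ p : {p : S × S // p.1 * p.2 = u}, p.1 ≠ (s, t) := by
      rintro ⟨_, hp⟩ rfl
      exact h hp.symm
    simp only [if_neg (hne _), tsum_zero]

variable {E : Type*} [NormedAddCommGroup E] [NormedSpace ℂ E]

/-- The values of a Hochschild cochain, or of any bounded multilinear map, on the point masses. -/
def onPointMasses {n : ℕ} (F : ContinuousMultilinearMap ℂ (fun _ : Fin n => EllOne S) E)
    (s : Fin n → S) : E :=
  F fun i => pointMass (s i)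

theorem norm_onPointMasses_le {n : ℕ}
    (F : ContinuousMultilinearMap ℂ (fun _ : Fin n => EllOne S) E) (s : Fin n → S) :
    ‖onPointMasses F s‖ ≤ ‖F‖ := by
  simpa [norm_pointMass] using! F.le_opNorm fun i => pointMass (s i)

theorem onPointMasses_cons {n : ℕ}
    (F : ContinuousMultilinearMap ℂ (fun _ : Fin (n + 1) => EllOne S) E) (s : S) (t : Fin n → S) :
    onPointMasses F (Fin.cons s t) = onPointMasses (F.curryLeft (pointMass s)) t :=
  congrArg F (Fin.comp_cons pointMass s t)

theorem clm_ext {f g : EllOne S →L[ℂ] E} (h : ∀ s, f (pointMass s) = g (pointMass s)) :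
    f = g := by
  classical
  refine lp.ext_continuousLinearMap (by simp) fun s => ?_
  ext
  exact h s

theorem onPointMasses_injective {n : ℕ} : Function.Injective
    (onPointMasses : ContinuousMultilinearMap ℂ (fun _ : Fin n => EllOne S) E → _) := by
  intro F G h
  induction n with
  | zero =>
    ext a
    rw [Subsingleton.elim a fun i => pointMass (i.elim0)]
    exact congrFun h Fin.elim0
  | succ n ih =>
    have hcurry : F.curryLeft = G.curryLeft := clm_ext fun s => ih <| funext fun t => by
      rw [← onPointMasses_cons, ← onPointMasses_cons, h]
    rw [← F.uncurry_curryLeft, hcurry, G.uncurry_curryLeft]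

variable [CompleteSpace E] {B : ℝ}

theorem exists_clm (hB : 0 ≤ B) {g : S → E} (hg : ∀ s, ‖g s‖ ≤ B) :
    ∃ f : EllOne S →L[ℂ] E, ‖f‖ ≤ B ∧ ∀ s, f (pointMass s) = g s := by
  classical
  let T := lp.mapCLM 1 (fun s => ContinuousLinearMap.toSpanSingleton ℂ (g s)) hB
    fun s => by simpa using hg s
  refine ⟨lp.tsumCLM ℂ S E ∘L T, ?_, fun s => ?_⟩
  · calc ‖lp.tsumCLM ℂ S E ∘L T‖
        ≤ ‖lp.tsumCLM ℂ S E‖ * ‖T‖ := ContinuousLinearMap.opNorm_comp_le _ _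
      _ ≤ 1 * B := mul_le_mul lp.norm_tsumCLM_le (lp.norm_mapCLM_le _ _ hB _) (norm_nonneg _)
          zero_le_one
      _ = B := one_mul B
  · change ∑' t, pointMass s t • g t = g s
    simp [pointMass_apply]

theorem exists_onPointMasses_eq (hB : 0 ≤ B) {n : ℕ} {g : (Fin n → S) → E}
    (hg : ∀ s, ‖g s‖ ≤ B) :
    ∃ F : ContinuousMultilinearMap ℂ (fun _ : Fin n => EllOne S) E,
      ‖F‖ ≤ B ∧ onPointMasses F = g := by
  induction n with
  | zero =>
    refine ⟨ContinuousMultilinearMap.constOfIsEmpty ℂ _ (g Fin.elim0), by simpa using hg _, ?_⟩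
    ext s
    exact congrArg g (Subsingleton.elim _ s)
  | succ n ih =>
    choose F hF hFg using fun s : S => ih (g := fun t => g (Fin.cons s t)) fun t => hg _
    obtain ⟨f, hf, hfF⟩ := exists_clm hB hF
    refine ⟨f.uncurryLeft, by rwa [ContinuousLinearMap.uncurryLeft_norm], ?_⟩
    ext s
    cases s using Fin.consCases with | _ s t =>
    rw [onPointMasses_cons, ContinuousLinearMap.curry_uncurryLeft, hfF, hFg]

end EllOne

namespace BanachBimodule

open EllOne

variable {S M : Type*} [NormedAddCommGroup M] [NormedSpace ℂ M]

/-- The action of `S` on a bimodule over `ℓ¹(S)`, through the point masses and on the left. -/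
def pointAction [Semigroup S] (X : BanachBimodule (EllOne S) M) : S →ₙ* Module.End ℂ M where
  toFun s := (X.left (pointMass s)).toLinearMap
  map_mul' s t := by
    ext x
    simp [← pointMass_mul, X.left_mul]

theorem norm_pointAction_le [Semigroup S] (X : BanachBimodule (EllOne S) M) (s : S) (x : M) :
    ‖X.pointAction s x‖ ≤ ‖X.left‖ * ‖x‖ := by
  simpa [norm_pointMass] using! X.left.le_opNorm₂ (pointMass s) x

theorem onPointMasses_coboundary [Semigroup S] {X : BanachBimodule (EllOne S) M}
    (hX : X.IsSymmetric) {n : ℕ} (F : HochschildCochain (EllOne S) M n) :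
    onPointMasses (Hochschild.coboundary X n F)
      = SemigroupCochain.coboundary X.pointAction n (onPointMasses F) := by
  ext s
  have hmul : ∀ j : Fin n, Fin.contractNth j.castSucc (· * ·) (fun i => pointMass (s i))
      = fun i => pointMass (Fin.contractNth j.castSucc (· * ·) s i) := fun j =>
    (Fin.comp_contractNth _ _ (fun x y => (pointMass_mul x y).symm) j.castSucc s).symm
  rw [SemigroupCochain.coboundary_apply, onPointMasses, Hochschild.coboundary_apply, ← hX]
  simp only [hmul]
  rfl

end BanachBimodule

end

open SemigroupCochain EllOne in
theorem corollary4p3 {S : Type*} [CommSemigroup S] (hS : ∀ s : S, IsIdempotentElem s)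
    {M : Type*} [NormedAddCommGroup M] [NormedSpace ℂ M] [CompleteSpace M]
    (X : BanachBimodule (EllOne S) M) (hX : X.IsSymmetric) (n : ℕ) (hn : 1 ≤ n) :
    Subsingleton (Hochschild.Cohomology X n) := by
  obtain ⟨n, rfl⟩ := Nat.exists_eq_add_of_le' hn
  rw [Submodule.Quotient.subsingleton_iff, Submodule.submoduleOf_eq_top]
  intro F hF
  let ρ := X.pointAction
  have hcocycle : coboundary ρ (n + 1) (onPointMasses F) = 0 := by
    rw [← BanachBimodule.onPointMasses_coboundary hX, LinearMap.mem_ker.1 hF]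
    rfl
  obtain ⟨D, hD, hbound⟩ := exists_norm_homotopy_le ρ (norm_nonneg X.left) X.norm_pointAction_le n
  obtain ⟨G, -, hG⟩ := exists_onPointMasses_eq (mul_nonneg hD (norm_nonneg F))
    (hbound (onPointMasses F) ‖F‖ (norm_nonneg F) (norm_onPointMasses_le F))
  refine ⟨G, onPointMasses_injective ?_⟩
  calc onPointMasses (Hochschild.coboundary X n G)
      = coboundary ρ n (homotopy ρ n (onPointMasses F)) := by
        rw [BanachBimodule.onPointMasses_coboundary hX, hG]
    _ = onPointMasses F - homotopy ρ (n + 1) (coboundary ρ (n + 1) (onPointMasses F)) := by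
        rw [homotopy_coboundary ρ hS, sub_sub_cancel]
    _ = onPointMasses F := by rw [hcocycle, map_zero, sub_zero]
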